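/- Let $\kappa\le\theta$ be cardinals and let $\lambda$ be an ordinal (for instance a cardinal). A *$\theta$-supercompactness embedding* for $\kappa$ is an elementary embedding $j\colon V\to M$ of the universe into a transitive class $M$ with critical point $\kappa$ such that $\theta<j(\kappa)$ and ${}^{\theta}M\subseteq M$. Write $H_{\theta^+}$ for the set of all $a$ whose transitive closure has cardinality at most $\theta$. A *$\theta$-supercompactness Laver function* for $\kappa$ is a function $\ell\colon\kappa\to V_\kappa$ such that for every $a\in H_{\theta^+}$ there is a $\theta$-supercompactness embedding $j$ for $\kappa$ with $j(\ell)(\kappa)=a$. A *$\theta$-supercompactness joint Laver sequence* for $\kappa$ of length $\lambda$ is a sequence $\langle \ell_\alpha:\alpha<\lambda\rangle$ of $\theta$-supercompactness Laver functions for $\kappa$ such that for every sequence $\langle a_\alpha:\alpha<\lambda\rangle$ of elements of $H_{\theta^+}$ there is a single $\theta$-supercompactness embedding $j$ for $\kappa$ with $j(\ell_\alpha)(\kappa)=a_\alpha$ for all $\alpha<\lambda$. A *normal measure* on $\mathcal{P}_\kappa(\theta)=\{x\subseteq\theta:|x|<\kappa\}$ is a $\kappa$-complete ultrafilter $U$ on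 $\mathcal{P}_\kappa(\theta)$ that is fine ($\{x:\alpha\in x\}\in U$ for all $\alpha<\theta$) and normal (every $f\colon\mathcal{P}_\kappa(\theta)\to\theta$ with $\{x:f(x)\in x\}\in U$ is constant on a set in $U$). If there is a $\theta$-supercompactness joint Laver sequence for $\kappa$ of length $\lambda$, then there are at least $2^{\theta\cdot|\lambda|}$ normal measures on $\mathcal{P}_\kappa(\theta)$ (cardinal arithmetic; for a cardinal $\lambda$ this is $2^{\theta\cdot\lambda}$). -/

import Mathlib

open Cardinal FirstOrder

universe u

namespace JointLaver

/-- Relation symbols of the language of set theory: one binary symbol. -/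
inductive SetRel : ℕ → Type
  | mem : SetRel 2

/-- The first-order language `{∈}` of set theory. -/
def setLanguage : Language := ⟨fun _ => Empty, SetRel⟩

/-- The universe of sets as an `{∈}`-structure. -/
instance universeStructure : setLanguage.Structure ZFSet.{u} where
  funMap f := Empty.elim f
  RelMap | .mem => fun v => v 0 ∈ v 1

/-- A class of sets as an `{∈}`-structure, with the true membership relation. -/
instance classStructure (M : Set ZFSet.{u}) : setLanguage.Structure M where
  funMap f := Empty.elim f
  RelMap | .mem => fun v => (v 0 : ZFSet.{u}) ∈ (v 1 : ZFSet.{u})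

/-- A `θ`-supercompactness embedding with critical point `κ`: an elementary embedding
`j : V → M` into a transitive class with critical point `κ`, `θ < j(κ)` and `^θ M ⊆ M`.
Neither `M` nor `j` is required to be definable. -/
structure SupercompactnessEmbedding (κ θ : Cardinal.{u}) where
  /-- The target model. -/
  M : Set ZFSet.{u}
  transitive : ∀ x ∈ M, ∀ y ∈ x, y ∈ M
  /-- The (fully) elementary embedding. -/
  j : ZFSet.{u} ↪ₑ[setLanguage] M
  fixes_below : ∀ α < κ.ord, (j α.toZFSet : ZFSet.{u}) = α.toZFSet
  moves_crit : (j κ.ord.toZFSet : ZFSet.{u}) ≠ κ.ord.toZFSet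
  lt_image_crit : θ.ord.toZFSet ∈ (j κ.ord.toZFSet : ZFSet.{u})
  closed : ∀ y f : ZFSet.{u}, (∀ z ∈ y, z ∈ M) → ZFSet.IsFunc θ.ord.toZFSet y f → f ∈ M

/-- `ℓ` guesses `a` via `j`, that is, `j(ℓ)(κ) = a`
(functions are sets of Kuratowski pairs). -/
def Guesses {κ θ : Cardinal.{u}} (E : SupercompactnessEmbedding κ θ) (ℓ a : ZFSet.{u}) : Prop :=
  ZFSet.pair κ.ord.toZFSet a ∈ (E.j ℓ : ZFSet.{u})

/-- `x ∈ H_μ`: the transitive closure of `x` has cardinality less than `μ`. -/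
def MemH (μ : Cardinal.{u}) (x : ZFSet.{u}) : Prop :=
  ∃ t : ZFSet.{u}, t.IsTransitive ∧ x ⊆ t ∧ t.card < μ

/-- `ℓ : κ → V_κ` is a `θ`-supercompactness Laver function for `κ`. -/
def IsLaverFunction (κ θ : Cardinal.{u}) (ℓ : ZFSet.{u}) : Prop :=
  ZFSet.IsFunc κ.ord.toZFSet (ZFSet.vonNeumann κ.ord) ℓ ∧
    ∀ a, MemH (Order.succ θ) a → ∃ E : SupercompactnessEmbedding κ θ, Guesses E ℓ a

/-- `⟨ℓ α : α < lam⟩` is a `θ`-supercompactness joint Laver sequence for `κ`. -/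
def IsJointLaverSequence (κ θ : Cardinal.{u}) (lam : Ordinal.{u})
    (ℓ : Set.Iio lam → ZFSet.{u}) : Prop :=
  (∀ α, IsLaverFunction κ θ (ℓ α)) ∧
    ∀ a : Set.Iio lam → ZFSet.{u}, (∀ α, MemH (Order.succ θ) (a α)) →
      ∃ E : SupercompactnessEmbedding κ θ, ∀ α, Guesses E (ℓ α) (a α)

/-- `P_κ(θ)`, the subsets of `θ` of size less than `κ`. -/
def PKappa (κ θ : Cardinal.{u}) : Type u :=
  {x : Set θ.ord.ToType // #x < κ}

/-- A normal measure on `P_κ(θ)`: a `κ`-complete, fine, normal ultrafilter. -/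
structure IsNormalMeasure {κ θ : Cardinal.{u}} (U : Ultrafilter (PKappa κ θ)) : Prop where
  complete : CardinalInterFilter (U : Filter (PKappa κ θ)) κ
  fine : ∀ a : θ.ord.ToType, ∀ᶠ x in (U : Filter (PKappa κ θ)), a ∈ x.1
  normal : ∀ f : PKappa κ θ → θ.ord.ToType,
    (∀ᶠ x in (U : Filter (PKappa κ θ)), f x ∈ x.1) →
      ∃ a, ∀ᶠ x in (U : Filter (PKappa κ θ)), f x = a

end JointLaver

/-! A supercompactness embedding `j` induces the measure `{X | j[θ] ∈ j(X)}` on `P_κ(θ)`, and Łoś's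
theorem computes truth about the sets `j(F)(j[θ])` from the measure. As `j[θ] ∩ j(κ) = κ` and the
Mostowski collapse of `j[θ]` sends `j(γ)` to `γ`, the functions `x ↦ x ∩ κ` and `x ↦ otp (x ∩ γ)`
represent `κ` and `γ`. Hence `γ ∈ j(ℓ)(κ)` exactly when `otp (x ∩ γ) ∈ ℓ(x ∩ κ)` for almost all `x`,
so the measure determines which subset of `θ` is guessed by each function of the joint Laver
sequence, and there are `2 ^ (θ * |λ|)` sequences of subsets to guess. -/

namespace JointLaver

open FirstOrder.Language

/-- An isomorphism of an `{∈}`-structure onto a transitive class, as a map into the universe. -/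
structure IsTransitiveEmbedding {A : Type*} [setLanguage.Structure A] (i : A → ZFSet.{u}) :
    Prop where
  injective : Function.Injective i
  relMap_mem : ∀ v : Fin 2 → A, Structure.RelMap (L := setLanguage) SetRel.mem v ↔ i (v 0) ∈ i (v 1)
  transitive : ∀ a, ∀ y ∈ i a, ∃ b, i b = y

theorem isTransitiveEmbedding_id : IsTransitiveEmbedding (id : ZFSet.{u} → ZFSet.{u}) where
  injective := Function.injective_id
  relMap_mem _ := Iff.rfl
  transitive _ y _ := ⟨y, rfl⟩

theorem isTransitiveEmbedding_val {M : Set ZFSet.{u}} (hM : ∀ x ∈ M, ∀ y ∈ x, y ∈ M) :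
    IsTransitiveEmbedding (Subtype.val : M → ZFSet.{u}) where
  injective := Subtype.val_injective
  relMap_mem _ := Iff.rfl
  transitive a y hy := ⟨⟨y, hM a a.2 y hy⟩, rfl⟩

/-- A predicate on assignments of sets is absolute if one formula defines it in every transitive
class. -/
def IsAbsolute {α : Type} (P : (α → ZFSet.{u}) → Prop) : Prop :=
  ∃ φ : setLanguage.Formula α, ∀ (A : Type (u + 1)) [setLanguage.Structure A] (i : A → ZFSet.{u}),
    IsTransitiveEmbedding i → ∀ v : α → A, φ.Realize v ↔ P fun a => i (v a)

namespace IsAbsolute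

variable {α : Type} {P Q : (α → ZFSet.{u}) → Prop}

theorem mem (a b : α) : IsAbsolute fun v : α → ZFSet.{u} => v a ∈ v b :=
  ⟨Relations.formula₂ (L := setLanguage) SetRel.mem (Term.var a) (Term.var b),
    fun _ _ _ hi _ => Formula.realize_rel₂.trans (hi.relMap_mem _)⟩

theorem eq (a b : α) : IsAbsolute fun v : α → ZFSet.{u} => v a = v b :=
  ⟨Term.equal (L := setLanguage) (Term.var a) (Term.var b),
    fun A _ i hi v => by rw [Formula.realize_equal]; exact hi.injective.eq_iff.symm⟩

theorem congr (hP : IsAbsolute P) (h : ∀ v, P v ↔ Q v) : IsAbsolute Q := by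
  rwa [← show P = Q from funext fun v => propext (h v)]

theorem comp {β : Type} {R : (β → ZFSet.{u}) → Prop} (hR : IsAbsolute R) (g : β → α) :
    IsAbsolute fun v => R fun b => v (g b) := by
  obtain ⟨φ, hφ⟩ := hR
  exact ⟨φ.relabel g, fun A _ i hi v => by rw [Formula.realize_relabel, hφ A i hi]; rfl⟩

theorem not (hP : IsAbsolute P) : IsAbsolute fun v => ¬ P v := by
  obtain ⟨φ, hφ⟩ := hP
  exact ⟨φ.not, fun A _ i hi v => by rw [Formula.realize_not, hφ A i hi]⟩

theorem and (hP : IsAbsolute P) (hQ : IsAbsolute Q) : IsAbsolute fun v => P v ∧ Q v := by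
  obtain ⟨φ, hφ⟩ := hP
  obtain ⟨ψ, hψ⟩ := hQ
  exact ⟨φ ⊓ ψ, fun A _ i hi v => by rw [Formula.realize_inf, hφ A i hi, hψ A i hi]⟩

theorem imp (hP : IsAbsolute P) (hQ : IsAbsolute Q) : IsAbsolute fun v => P v → Q v := by
  obtain ⟨φ, hφ⟩ := hP
  obtain ⟨ψ, hψ⟩ := hQ
  exact ⟨φ.imp ψ, fun A _ i hi v => by rw [Formula.realize_imp, hφ A i hi, hψ A i hi]⟩

theorem or (hP : IsAbsolute P) (hQ : IsAbsolute Q) : IsAbsolute fun v => P v ∨ Q v :=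
  (hP.not.imp hQ).congr fun _ => or_iff_not_imp_left.symm

theorem iff (hP : IsAbsolute P) (hQ : IsAbsolute Q) : IsAbsolute fun v => (P v ↔ Q v) :=
  ((hP.imp hQ).and (hQ.imp hP)).congr fun _ => iff_iff_implies_and_implies.symm

theorem forall_finite {ι : Type*} [Finite ι] {R : ι → (α → ZFSet.{u}) → Prop}
    (hR : ∀ k, IsAbsolute (R k)) : IsAbsolute fun v => ∀ k, R k v := by
  choose φ hφ using hR
  exact ⟨Formula.iInf φ, fun A _ i hi v => by
    rw [Formula.realize_iInf]; exact forall_congr' fun k => hφ k A i hi v⟩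

theorem bex {R : (α → ZFSet.{u}) → ZFSet.{u} → Prop} (b : α)
    (hR : IsAbsolute fun w : α ⊕ Unit → ZFSet.{u} => R (fun a => w (.inl a)) (w (.inr ()))) :
    IsAbsolute fun v => ∃ z ∈ v b, R v z := by
  obtain ⟨φ, hφ⟩ := (mem (.inr ()) (.inl b)).and hR
  refine ⟨φ.iExs Unit, fun A _ i hi v => ?_⟩
  simp only [Formula.realize_iExs, hφ A i hi, Sum.elim_inl, Sum.elim_inr]
  constructor
  · rintro ⟨f, hf⟩
    exact ⟨_, hf⟩
  · rintro ⟨z, hz, h⟩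
    obtain ⟨c, rfl⟩ := hi.transitive _ _ hz
    exact ⟨fun _ => c, hz, h⟩

theorem ball {R : (α → ZFSet.{u}) → ZFSet.{u} → Prop} (b : α)
    (hR : IsAbsolute fun w : α ⊕ Unit → ZFSet.{u} => R (fun a => w (.inl a)) (w (.inr ()))) :
    IsAbsolute fun v => ∀ z ∈ v b, R v z :=
  (bex (R := fun v z => ¬ R v z) b hR.not).not.congr fun _ => by push Not; rfl

theorem eq_unorderedPair (s a b : α) :
    IsAbsolute fun v : α → ZFSet.{u} => v s = {v a, v b} := by
  have h : IsAbsolute fun v : α → ZFSet.{u} =>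
      v a ∈ v s ∧ v b ∈ v s ∧ ∀ z ∈ v s, z = v a ∨ z = v b :=
    .and (.mem _ _) (.and (.mem _ _) (.ball _ (.or (.eq _ _) (.eq _ _))))
  refine h.congr fun v => ⟨fun ⟨ha, hb, h⟩ => ?_, fun h => by simp [h]⟩
  ext z
  rw [ZFSet.mem_pair]
  exact ⟨h z, by rintro (rfl | rfl) <;> assumption⟩

theorem eq_pair (p a b : α) :
    IsAbsolute fun v : α → ZFSet.{u} => v p = ZFSet.pair (v a) (v b) := by
  have h : IsAbsolute fun v : α → ZFSet.{u} =>
      ∃ s ∈ v p, ∃ t ∈ v p, s = {v a, v a} ∧ t = {v a, v b} ∧ v p = {s, t} :=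
    .bex _ (.bex _ (.and (.eq_unorderedPair _ _ _)
      (.and (.eq_unorderedPair _ _ _) (.eq_unorderedPair _ _ _))))
  refine h.congr fun v => ⟨?_, fun h => ⟨{v a, v a}, ?_, {v a, v b}, ?_, rfl, rfl, ?_⟩⟩
  · rintro ⟨_, -, _, -, rfl, rfl, h⟩
    simpa [ZFSet.pair] using h
  all_goals simp [h, ZFSet.pair]

theorem pair_mem (a b c : α) :
    IsAbsolute fun v : α → ZFSet.{u} => ZFSet.pair (v a) (v b) ∈ v c := by
  have h : IsAbsolute fun v : α → ZFSet.{u} => ∃ p ∈ v c, p = ZFSet.pair (v a) (v b) :=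
    bex _ (eq_pair _ _ _)
  exact h.congr fun v => exists_eq_right

theorem isFunc (x y f : α) :
    IsAbsolute fun v : α → ZFSet.{u} => ZFSet.IsFunc (v x) (v y) (v f) := by
  have h : IsAbsolute fun v : α → ZFSet.{u} =>
      (∀ p ∈ v f, ∃ a ∈ v x, ∃ b ∈ v y, p = ZFSet.pair a b) ∧
        ∀ a ∈ v x, ∃ b ∈ v y, ZFSet.pair a b ∈ v f ∧ ∀ c ∈ v y, ZFSet.pair a c ∈ v f → c = b :=
    .and (.ball _ (.bex _ (.bex _ (.eq_pair _ _ _))))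
      (.ball _ (.bex _ (.and (.pair_mem _ _ _) (.ball _ (.imp (.pair_mem _ _ _) (.eq _ _))))))
  refine h.congr fun v => (and_congr_left' ?_).trans (and_congr_right fun hf => ?_)
  · exact forall₂_congr fun _ _ => ZFSet.mem_prod.symm
  · refine forall₂_congr fun a _ => ⟨?_, ?_⟩
    · rintro ⟨b, -, hb, huniq⟩
      exact ⟨b, hb, fun c hc => huniq c (ZFSet.pair_mem_prod.1 (hf hc)).2 hc⟩
    · rintro ⟨b, hb, huniq⟩
      exact ⟨b, (ZFSet.pair_mem_prod.1 (hf hb)).2, hb, fun c _ => huniq c⟩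

end IsAbsolute

namespace SupercompactnessEmbedding

variable {κ θ : Cardinal.{u}} (E : SupercompactnessEmbedding κ θ) {α : Type}

theorem transfer {P : (α → ZFSet.{u}) → Prop} (hP : IsAbsolute P) (v : α → ZFSet.{u}) :
    (P fun a => E.j (v a)) ↔ P v := by
  obtain ⟨φ, hφ⟩ := hP
  rw [← hφ _ _ (isTransitiveEmbedding_val E.transitive) fun a => E.j (v a)]
  exact (E.j.map_formula φ v).trans (hφ _ _ isTransitiveEmbedding_id v)

theorem transfer_forall {β : Type} [Finite β] {P : (α → ZFSet.{u}) → (β → ZFSet.{u}) → Prop}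
    (hP : IsAbsolute fun w : α ⊕ β → ZFSet.{u} => P (fun a => w (.inl a)) fun b => w (.inr b))
    (v : α → ZFSet.{u}) (h : ∀ z, P v z) (z : β → ZFSet.{u}) (hz : ∀ b, z b ∈ E.M) :
    P (fun a => E.j (v a)) z := by
  obtain ⟨φ, hφ⟩ := hP
  have hV : (φ.iAlls β).Realize v :=
    Formula.realize_iAlls.2 fun f => (hφ _ _ isTransitiveEmbedding_id _).2 (h _)
  rw [← E.j.map_formula, Formula.realize_iAlls] at hV
  exact (hφ _ _ (isTransitiveEmbedding_val E.transitive) _).1 (hV fun b => ⟨z b, hz b⟩)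

theorem image_mem_image_iff {a b : ZFSet.{u}} : (E.j a : ZFSet.{u}) ∈ (E.j b : ZFSet.{u}) ↔ a ∈ b :=
  E.transfer (.mem (0 : Fin 2) 1) ![a, b]

end SupercompactnessEmbedding

theorem eq_of_pair_mem_of_isFunc {x y f a b c : ZFSet.{u}} (hf : ZFSet.IsFunc x y f)
    (hb : ZFSet.pair a b ∈ f) (hc : ZFSet.pair a c ∈ f) : b = c :=
  (hf.2 a (ZFSet.pair_mem_prod.1 (hf.1 hb)).1).unique hb hc

section Coding

variable {α : Type u} {e : α → ZFSet.{u}}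

/-- The image of `s` under `e`, as a `ZFSet`. -/
noncomputable def imageSet (e : α → ZFSet.{u}) (s : Set α) : ZFSet.{u} :=
  ZFSet.range fun a : s => e a

theorem mem_imageSet {s : Set α} {z : ZFSet.{u}} : z ∈ imageSet e s ↔ ∃ a ∈ s, e a = z := by
  simp [imageSet]

theorem apply_mem_imageSet_iff (he : Function.Injective e) {s : Set α} {a : α} :
    e a ∈ imageSet e s ↔ a ∈ s := by
  simp [mem_imageSet, he.eq_iff]

/-- The set of pairs `(e a, F a)`: the graph of `F`, with arguments coded by `e`. -/
noncomputable def graph (e F : α → ZFSet.{u}) : ZFSet.{u} :=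
  ZFSet.range fun a => ZFSet.pair (e a) (F a)

theorem pair_mem_graph {F : α → ZFSet.{u}} {y z : ZFSet.{u}} :
    ZFSet.pair y z ∈ graph e F ↔ ∃ a, e a = y ∧ F a = z := by
  simp [graph, ZFSet.pair_inj]

theorem apply_pair_mem_graph_iff (he : Function.Injective e) {F : α → ZFSet.{u}} {a : α}
    {z : ZFSet.{u}} : ZFSet.pair (e a) z ∈ graph e F ↔ F a = z := by
  simp [pair_mem_graph, he.eq_iff]

end Coding

section Ordinals

variable {o : Ordinal.{u}}

/-- The von Neumann ordinal named by an element of `o.ToType`. -/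
noncomputable def ordinalSet (a : o.ToType) : ZFSet.{u} :=
  (a.toOrd : Ordinal.{u}).toZFSet

theorem ordinalSet_injective : Function.Injective (ordinalSet (o := o)) :=
  fun _ _ h => Ordinal.ToType.mk.symm.injective (Subtype.ext (Ordinal.toZFSet_injective h))

theorem ordinalSet_mem_toZFSet_iff {a : o.ToType} {β : Ordinal.{u}} :
    ordinalSet a ∈ β.toZFSet ↔ a.toOrd < β :=
  Ordinal.toZFSet_mem_toZFSet_iff

theorem imageSet_ordinalSet_setOf_lt {β : Ordinal.{u}} (hβ : β ≤ o) :
    imageSet ordinalSet {a : o.ToType | a.toOrd < β} = β.toZFSet := by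
  ext z
  rw [mem_imageSet, Ordinal.mem_toZFSet_iff]
  constructor
  · rintro ⟨a, ha, rfl⟩
    exact ⟨_, ha, rfl⟩
  · rintro ⟨γ, hγ, rfl⟩
    exact ⟨Ordinal.ToType.mk ⟨γ, hγ.trans_le hβ⟩, by simpa using hγ, by simp [ordinalSet]⟩

theorem imageSet_ordinalSet_univ : imageSet ordinalSet (Set.univ : Set o.ToType) = o.toZFSet := by
  rw [← imageSet_ordinalSet_setOf_lt le_rfl]
  exact congrArg _ (Set.eq_univ_of_forall fun a => a.toOrd.2).symm

theorem mem_toZFSet_iff_exists_ordinalSet {z : ZFSet.{u}} :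
    z ∈ o.toZFSet ↔ ∃ a : o.ToType, ordinalSet a = z := by
  simp [← imageSet_ordinalSet_univ, mem_imageSet]

theorem mem_ordinalSet_iff {a : o.ToType} {z : ZFSet.{u}} :
    z ∈ ordinalSet a ↔ ∃ b < a, ordinalSet b = z := by
  rw [ordinalSet, ← imageSet_ordinalSet_setOf_lt a.toOrd.2.le, mem_imageSet]
  simp

theorem imageSet_ordinalSet_injective : Function.Injective (imageSet (ordinalSet (o := o))) :=
  fun x y h => Set.ext fun a => by
    rw [← apply_mem_imageSet_iff ordinalSet_injective, h,
      apply_mem_imageSet_iff ordinalSet_injective]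

theorem memH_imageSet_ordinalSet {θ : Cardinal.{u}} (x : Set θ.ord.ToType) :
    MemH (Order.succ θ) (imageSet ordinalSet x) := by
  refine ⟨θ.ord.toZFSet, (ZFSet.isOrdinal_toZFSet _).isTransitive, fun z hz => ?_, by simp⟩
  obtain ⟨a, -, rfl⟩ := mem_imageSet.1 hz
  exact ordinalSet_mem_toZFSet_iff.2 a.toOrd.2

end Ordinals

variable {κ θ : Cardinal.{u}}

/-- An element of `P_κ(θ)` as a set of von Neumann ordinals. -/
noncomputable def point (x : PKappa κ θ) : ZFSet.{u} :=
  imageSet ordinalSet x.1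

theorem point_injective : Function.Injective (point (κ := κ) (θ := θ)) :=
  fun _ _ h => Subtype.ext (imageSet_ordinalSet_injective h)

theorem ordinalSet_mem_point_iff {a : θ.ord.ToType} {x : PKappa κ θ} :
    ordinalSet a ∈ point x ↔ a ∈ x.1 :=
  apply_mem_imageSet_iff ordinalSet_injective

variable (κ θ) in
/-- `P_κ(θ)` as a set of sets of von Neumann ordinals. -/
noncomputable def pKappaSet : ZFSet.{u} :=
  imageSet point (Set.univ : Set (PKappa κ θ))

theorem forall_mem_pKappaSet {p : ZFSet.{u} → Prop} :
    (∀ z ∈ pKappaSet κ θ, p z) ↔ ∀ x : PKappa κ θ, p (point x) := by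
  simp [pKappaSet, mem_imageSet]

theorem exists_mem_pKappaSet_of_isFunc {f α : ZFSet.{u}} (hα : α ∈ κ.ord.toZFSet)
    (hf : ZFSet.IsFunc α θ.ord.toZFSet f) :
    ∃ x ∈ pKappaSet κ θ, (∀ b ∈ x, ∃ a ∈ α, ZFSet.pair a b ∈ f) ∧
      ∀ a ∈ α, ∀ b ∈ θ.ord.toZFSet, ZFSet.pair a b ∈ f → b ∈ x := by
  obtain ⟨β, hβ, rfl⟩ := Ordinal.mem_toZFSet_iff.1 hα
  have hvalue (a : β.ToType) :
      ∃ b : θ.ord.ToType, ZFSet.pair (ordinalSet a) (ordinalSet b) ∈ f := by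
    obtain ⟨b, hb, -⟩ := hf.2 _ (mem_toZFSet_iff_exists_ordinalSet.2 ⟨a, rfl⟩)
    obtain ⟨b, rfl⟩ := mem_toZFSet_iff_exists_ordinalSet.1 (ZFSet.pair_mem_prod.1 (hf.1 hb)).2
    exact ⟨b, hb⟩
  choose g hg using hvalue
  have hcard : #(Set.range g) < κ := mk_range_le.trans_lt (by simpa using lt_ord.1 hβ)
  refine ⟨point ⟨Set.range g, hcard⟩, mem_imageSet.2 ⟨_, trivial, rfl⟩, fun b hb => ?_,
    fun a ha b _ hab => ?_⟩
  · obtain ⟨_, ⟨a, rfl⟩, rfl⟩ := mem_imageSet.1 hb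
    exact ⟨_, mem_toZFSet_iff_exists_ordinalSet.2 ⟨a, rfl⟩, hg a⟩
  · obtain ⟨a, rfl⟩ := mem_toZFSet_iff_exists_ordinalSet.1 ha
    rw [eq_of_pair_mem_of_isFunc hf hab (hg a)]
    exact ordinalSet_mem_point_iff.2 ⟨a, rfl⟩

namespace SupercompactnessEmbedding

variable (E : SupercompactnessEmbedding κ θ)

/-- The pointwise image `j[θ]`, the seed of the measure derived from `j`. -/
noncomputable def seed : ZFSet.{u} :=
  ZFSet.range fun a : θ.ord.ToType => (E.j (ordinalSet a) : ZFSet.{u})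

theorem mem_seed {z : ZFSet.{u}} : z ∈ E.seed ↔ ∃ a : θ.ord.ToType, E.j (ordinalSet a) = z := by
  simp only [seed, ZFSet.mem_range]

/-- The restriction of `j` to `θ`. -/
noncomputable def restriction : ZFSet.{u} :=
  graph (ordinalSet (o := θ.ord)) fun a => E.j (ordinalSet a)

theorem isFunc_restriction : ZFSet.IsFunc θ.ord.toZFSet (E.j θ.ord.toZFSet) E.restriction := by
  refine ⟨fun p hp => ?_, fun z hz => ?_⟩
  · obtain ⟨a, rfl⟩ := ZFSet.mem_range.1 hp
    have ha := mem_toZFSet_iff_exists_ordinalSet.2 ⟨a, rfl⟩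
    exact ZFSet.pair_mem_prod.2 ⟨ha, E.image_mem_image_iff.2 ha⟩
  · obtain ⟨a, rfl⟩ := mem_toZFSet_iff_exists_ordinalSet.1 hz
    simp [restriction, apply_pair_mem_graph_iff ordinalSet_injective]

theorem restriction_mem : E.restriction ∈ E.M :=
  E.closed _ _ (E.transitive _ (E.j _).2) E.isFunc_restriction

/-- By closure, `j ↾ θ` lies in `M`, so `M` sees `j[θ]` as the range of a function on `θ < j(κ)`. -/
theorem seed_mem_image_pKappaSet : E.seed ∈ (E.j (pKappaSet κ θ) : ZFSet.{u}) := by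
  obtain ⟨x, hx, hsub, hsup⟩ := E.transfer_forall (α := Fin 3) (β := Unit)
    (P := fun v f => ∀ α ∈ v 0, ZFSet.IsFunc α (v 1) (f ()) → ∃ x ∈ v 2,
      (∀ b ∈ x, ∃ a ∈ α, ZFSet.pair a b ∈ f ()) ∧
        ∀ a ∈ α, ∀ b ∈ v 1, ZFSet.pair a b ∈ f () → b ∈ x)
    (.ball _ (.imp (.isFunc _ _ _) (.bex _ (.and (.ball _ (.bex _ (.pair_mem _ _ _)))
      (.ball _ (.ball _ (.imp (.pair_mem _ _ _) (.mem _ _))))))))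
    ![κ.ord.toZFSet, θ.ord.toZFSet, pKappaSet κ θ]
    (fun _ _ hα hf => exists_mem_pKappaSet_of_isFunc hα hf)
    (fun _ => E.restriction) (fun _ => E.restriction_mem) θ.ord.toZFSet E.lt_image_crit
    E.isFunc_restriction
  suffices E.seed = x from this ▸ hx
  ext z
  rw [mem_seed]
  constructor
  · rintro ⟨a, rfl⟩
    have ha := mem_toZFSet_iff_exists_ordinalSet.2 ⟨a, rfl⟩
    exact hsup _ ha _ (E.image_mem_image_iff.2 ha) (pair_mem_graph.2 ⟨a, rfl, rfl⟩)
  · intro hz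
    obtain ⟨_, -, h⟩ := hsub z hz
    obtain ⟨a, -, ha⟩ := pair_mem_graph.1 h
    exact ⟨a, ha⟩

/-- `y = j(F)(j[θ])`, that is, `F` represents `y` in the ultrapower by the derived measure. -/
def Represents (F : PKappa κ θ → ZFSet.{u}) (y : ZFSet.{u}) : Prop :=
  ZFSet.pair E.seed y ∈ (E.j (graph point F) : ZFSet.{u})

theorem represents_const (z : ZFSet.{u}) : E.Represents (fun _ => z) (E.j z) :=
  (E.transfer (P := fun v : Fin 3 → ZFSet.{u} => ∀ x ∈ v 0, ZFSet.pair x (v 1) ∈ v 2)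
    (.ball _ (.pair_mem _ _ _)) ![pKappaSet κ θ, z, graph point fun _ : PKappa κ θ => z]).2
    (forall_mem_pKappaSet.2 fun x => pair_mem_graph.2 ⟨x, rfl, rfl⟩) _ E.seed_mem_image_pKappaSet

theorem represents_point : E.Represents point E.seed :=
  (E.transfer (P := fun v : Fin 2 → ZFSet.{u} => ∀ x ∈ v 0, ZFSet.pair x x ∈ v 1)
    (.ball _ (.pair_mem _ _ _)) ![pKappaSet κ θ, graph point (point (κ := κ) (θ := θ))]).2
    (forall_mem_pKappaSet.2 fun x => pair_mem_graph.2 ⟨x, rfl, rfl⟩) _ E.seed_mem_image_pKappaSet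

theorem exists_represents (F : PKappa κ θ → ZFSet.{u}) : ∃ y, E.Represents F y := by
  obtain ⟨y, -, hy⟩ := (E.transfer
    (P := fun v : Fin 3 → ZFSet.{u} => ∀ x ∈ v 0, ∃ y ∈ v 1, ZFSet.pair x y ∈ v 2)
    (.ball _ (.bex _ (.pair_mem _ _ _))) ![pKappaSet κ θ, ZFSet.range F, graph point F]).2
    (forall_mem_pKappaSet.2 fun x =>
      ⟨F x, ZFSet.mem_range_self x, pair_mem_graph.2 ⟨x, rfl, rfl⟩⟩) _ E.seed_mem_image_pKappaSet
  exact ⟨y, hy⟩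

variable {E} in
theorem Represents.mem {F : PKappa κ θ → ZFSet.{u}} {y : ZFSet.{u}} (h : E.Represents F y) :
    y ∈ E.M :=
  E.transitive _ (E.transitive _ (E.transitive _ (E.j _).2 _ h) {E.seed, y} (by simp [ZFSet.pair]))
    _ (by simp)

/-- `X` has measure one for the measure derived from `j`. -/
def Large (X : Set (PKappa κ θ)) : Prop :=
  E.seed ∈ (E.j (imageSet point X) : ZFSet.{u})

theorem large_setOf_iff_of_represents {ι : Type} [Finite ι] {P : (ι → ZFSet.{u}) → Prop}
    (hP : IsAbsolute P) {F : ι → PKappa κ θ → ZFSet.{u}} {y : ι → ZFSet.{u}}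
    (hy : ∀ i, E.Represents (F i) (y i)) : E.Large {x | P fun i => F i x} ↔ P y := by
  have hV : ∀ y : ι → ZFSet.{u}, ∀ x ∈ pKappaSet κ θ,
      (∀ i, ZFSet.pair x (y i) ∈ graph point (F i)) →
        (x ∈ imageSet point {x | P fun i => F i x} ↔ P y) := fun y =>
    forall_mem_pKappaSet.2 fun x hx => by
      obtain rfl : (fun i => F i x) = y :=
        funext fun i => (apply_pair_mem_graph_iff point_injective).1 (hx i)
      exact apply_mem_imageSet_iff point_injective
  exact E.transfer_forall (α := ι ⊕ Fin 2)
    (P := fun v y => ∀ x ∈ v (.inr 0), (∀ i, ZFSet.pair x (y i) ∈ v (.inl i)) →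
      (x ∈ v (.inr 1) ↔ P y))
    (.ball _ (.imp (.forall_finite fun _ => .pair_mem _ _ _)
      (.iff (.mem _ _) (hP.comp _))))
    (Sum.elim (fun i => graph point (F i))
      ![pKappaSet κ θ, imageSet point {x | P fun i => F i x}])
    hV y (fun i => (hy i).mem) _ E.seed_mem_image_pKappaSet hy

/-- `j(F)(j[θ])`, the set represented by `F`. -/
noncomputable def eval (F : PKappa κ θ → ZFSet.{u}) : ZFSet.{u} :=
  (E.exists_represents F).choose

theorem represents_eval (F : PKappa κ θ → ZFSet.{u}) : E.Represents F (E.eval F) :=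
  (E.exists_represents F).choose_spec

theorem large_univ : E.Large Set.univ :=
  E.seed_mem_image_pKappaSet

variable {E} in
theorem Represents.eval_eq {F : PKappa κ θ → ZFSet.{u}} {y : ZFSet.{u}} (h : E.Represents F y) :
    E.eval F = y :=
  (E.large_setOf_iff_of_represents (.eq (0 : Fin 2) 1) (F := ![F, F]) (y := ![E.eval F, y])
    (Fin.forall_fin_two.2 ⟨E.represents_eval F, h⟩)).1 (by simpa using E.large_univ)

theorem eval_const (z : ZFSet.{u}) : E.eval (fun _ => z) = E.j z :=
  (E.represents_const z).eval_eq

theorem eval_point : E.eval point = E.seed :=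
  E.represents_point.eval_eq

theorem large_setOf_iff {ι : Type} [Finite ι] {P : (ι → ZFSet.{u}) → Prop} (hP : IsAbsolute P)
    (F : ι → PKappa κ θ → ZFSet.{u}) :
    E.Large {x | P fun i => F i x} ↔ P fun i => E.eval (F i) :=
  E.large_setOf_iff_of_represents hP fun i => E.represents_eval (F i)

theorem large_compl_iff {X : Set (PKappa κ θ)} : E.Large Xᶜ ↔ ¬ E.Large X := by
  have h := E.large_setOf_iff (P := fun v : Fin 2 → ZFSet.{u} => ¬ v 0 ∈ v 1) (.not (.mem _ _))
    ![point, fun _ => imageSet point X]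
  simp only [Matrix.cons_val, apply_mem_imageSet_iff point_injective, eval_const, eval_point] at h
  exact h

theorem large_inter_iff {X Y : Set (PKappa κ θ)} :
    E.Large (X ∩ Y) ↔ E.Large X ∧ E.Large Y := by
  have h := E.large_setOf_iff (P := fun v : Fin 3 → ZFSet.{u} => v 0 ∈ v 1 ∧ v 0 ∈ v 2)
    (.and (.mem _ _) (.mem _ _)) ![point, fun _ => imageSet point X, fun _ => imageSet point Y]
  simp only [Matrix.cons_val, apply_mem_imageSet_iff point_injective, eval_const, eval_point] at h
  exact h

/-- The ultrafilter `{X | j[θ] ∈ j(X)}` on `P_κ(θ)` derived from `j`. -/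
def measure : Ultrafilter (PKappa κ θ) :=
  Ultrafilter.ofComplNotMemIff
    { sets := {X | E.Large X}
      univ_sets := E.large_univ
      sets_of_superset := fun hX hXY => by
        rw [← Set.inter_eq_left.2 hXY] at hX
        exact (E.large_inter_iff.1 hX).2
      inter_sets := fun hX hY => E.large_inter_iff.2 ⟨hX, hY⟩ }
    fun _ => (not_congr E.large_compl_iff).trans not_not

/-- The theorem of Łoś for the derived measure. -/
theorem eventually_measure_iff {ι : Type} [Finite ι] {P : (ι → ZFSet.{u}) → Prop}
    (hP : IsAbsolute P) (F : ι → PKappa κ θ → ZFSet.{u}) :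
    (∀ᶠ x in (E.measure : Filter (PKappa κ θ)), P fun i => F i x) ↔ P fun i => E.eval (F i) :=
  E.large_setOf_iff hP F

theorem eventually_mem_iff (F G : PKappa κ θ → ZFSet.{u}) :
    (∀ᶠ x in (E.measure : Filter (PKappa κ θ)), F x ∈ G x) ↔ E.eval F ∈ E.eval G :=
  E.eventually_measure_iff (.mem (0 : Fin 2) 1) ![F, G]

theorem eventually_eq_iff (F G : PKappa κ θ → ZFSet.{u}) :
    (∀ᶠ x in (E.measure : Filter (PKappa κ θ)), F x = G x) ↔ E.eval F = E.eval G :=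
  E.eventually_measure_iff (.eq (0 : Fin 2) 1) ![F, G]

theorem eventually_mem_measure (a : θ.ord.ToType) :
    ∀ᶠ x in (E.measure : Filter (PKappa κ θ)), a ∈ x.1 := by
  have h : E.eval (fun _ => ordinalSet a) ∈ E.eval point := by
    rw [eval_const, eval_point]
    exact E.mem_seed.2 ⟨a, rfl⟩
  exact ((E.eventually_mem_iff _ _).2 h).mono fun _ => ordinalSet_mem_point_iff.1

theorem exists_eventually_eq (f : PKappa κ θ → θ.ord.ToType)
    (hf : ∀ᶠ x in (E.measure : Filter (PKappa κ θ)), f x ∈ x.1) :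
    ∃ a, ∀ᶠ x in (E.measure : Filter (PKappa κ θ)), f x = a := by
  have hmem : E.eval (fun x => ordinalSet (f x)) ∈ E.seed := by
    rw [← eval_point, ← eventually_mem_iff]
    exact hf.mono fun _ => ordinalSet_mem_point_iff.2
  obtain ⟨a, ha⟩ := E.mem_seed.1 hmem
  rw [← eval_const, eq_comm, ← eventually_eq_iff] at ha
  exact ⟨a, ha.mono fun _ h => ordinalSet_injective h⟩

theorem image_ordinalSet {β : Ordinal.{u}} (hβ : β ≤ κ.ord) (a : β.ToType) :
    (E.j (ordinalSet a) : ZFSet.{u}) = ordinalSet a :=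
  E.fixes_below _ (a.toOrd.2.trans_le hβ)

theorem eventually_forall_mem {β : Ordinal.{u}} (hβ : β < κ.ord)
    (X : β.ToType → Set (PKappa κ θ))
    (hX : ∀ a, ∀ᶠ x in (E.measure : Filter (PKappa κ θ)), x ∈ X a) :
    ∀ᶠ x in (E.measure : Filter (PKappa κ θ)), ∀ a, x ∈ X a := by
  have hsub : β.toZFSet ⊆ E.eval fun x => imageSet ordinalSet {a | x ∈ X a} := by
    intro z hz
    obtain ⟨a, rfl⟩ := mem_toZFSet_iff_exists_ordinalSet.1 hz
    rw [← E.image_ordinalSet hβ.le, ← eval_const, ← eventually_mem_iff]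
    exact (hX a).mono fun x hx => mem_imageSet.2 ⟨a, hx, rfl⟩
  rw [← E.fixes_below β hβ, ← eval_const] at hsub
  have h := (E.eventually_measure_iff (P := fun v : Fin 2 → ZFSet.{u} => ∀ z ∈ v 0, z ∈ v 1)
    (.ball _ (.mem _ _))
    ![fun _ => β.toZFSet, fun x => imageSet ordinalSet {a | x ∈ X a}]).2 hsub
  exact h.mono fun x hx a => (apply_mem_imageSet_iff ordinalSet_injective).1
    (hx _ (mem_toZFSet_iff_exists_ordinalSet.2 ⟨a, rfl⟩))

theorem isNormalMeasure_measure : IsNormalMeasure E.measure where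
  complete := ⟨fun S hS h => by
    obtain ⟨e⟩ : Nonempty ((#S).ord.ToType ≃ S) := Cardinal.eq.1 (by simp)
    filter_upwards [E.eventually_forall_mem (ord_lt_ord.2 hS) (fun a => e a) fun a => h _ (e a).2]
      with x hx
    exact fun s hs => by simpa using hx (e.symm ⟨s, hs⟩)⟩
  fine := E.eventually_mem_measure
  normal := E.exists_eventually_eq

/-- Normality, stated for diagonal unions of set-valued functions. -/
theorem mem_eval_iff_of_forall_mem_iff {F : PKappa κ θ → ZFSet.{u}}
    {G : θ.ord.ToType → PKappa κ θ → ZFSet.{u}} {s : Set θ.ord.ToType}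
    (hF : ∀ x z, z ∈ F x ↔ ∃ a ∈ x.1, a ∈ s ∧ G a x = z) {z : ZFSet.{u}} :
    z ∈ E.eval F ↔ ∃ a ∈ s, E.eval (G a) = z := by
  constructor
  · intro hz
    let C (x : PKappa κ θ) : ZFSet.{u} := graph ordinalSet fun a => G a x
    obtain ⟨δ, hδ, hδs, hpair⟩ := (E.eventually_measure_iff
      (P := fun v : Fin 4 → ZFSet.{u} => ∀ z ∈ v 0, ∃ δ ∈ v 1, δ ∈ v 2 ∧ ZFSet.pair δ z ∈ v 3)
      (.ball _ (.bex _ (.and (.mem _ _) (.pair_mem _ _ _))))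
      ![F, point, fun _ => imageSet ordinalSet s, C]).1
      (.of_forall fun x z hz => by
        obtain ⟨a, hax, has, haz⟩ := (hF x z).1 hz
        exact ⟨ordinalSet a, ordinalSet_mem_point_iff.2 hax,
          (apply_mem_imageSet_iff ordinalSet_injective).2 has, pair_mem_graph.2 ⟨a, rfl, haz⟩⟩)
      z hz
    have hδseed : δ ∈ E.eval point := hδ
    rw [eval_point] at hδseed
    obtain ⟨a, rfl⟩ := E.mem_seed.1 hδseed
    have has : a ∈ s := by
      rw [← apply_mem_imageSet_iff ordinalSet_injective, ← E.image_mem_image_iff, ← eval_const]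
      exact hδs
    have hfun := (E.eventually_measure_iff
      (P := fun v : Fin 4 → ZFSet.{u} => ∀ z ∈ v 0, ZFSet.pair (v 1) z ∈ v 2 → v 3 = z)
      (.ball _ (.imp (.pair_mem _ _ _) (.eq _ _))) ![F, fun _ => ordinalSet a, C, G a]).1
      (.of_forall fun x z _ => (apply_pair_mem_graph_iff ordinalSet_injective).1)
    refine ⟨a, has, hfun z hz ?_⟩
    change ZFSet.pair (E.eval fun _ => ordinalSet a) z ∈ E.eval C
    rw [eval_const]
    exact hpair
  · rintro ⟨a, has, rfl⟩
    rw [← eventually_mem_iff]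
    exact (E.eventually_mem_measure a).mono fun x hax => (hF x _).2 ⟨a, hax, has, rfl⟩

end SupercompactnessEmbedding

/-- The Mostowski collapse of `x` at `a`. If `<` is a well-order, this is the order type of
`{b ∈ x | b < a}` as a von Neumann ordinal. -/
noncomputable def collapse {α : Type u} [Preorder α] [WellFoundedLT α] (x : Set α) (a : α) :
    ZFSet.{u} :=
  ZFSet.range fun b : {b // b ∈ x ∧ b < a} => collapse x b.1
termination_by wellFounded_lt.wrap a
decreasing_by exact b.2.2

theorem mem_collapse {α : Type u} [Preorder α] [WellFoundedLT α] {x : Set α} {a : α}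
    {z : ZFSet.{u}} : z ∈ collapse x a ↔ ∃ b ∈ x, b < a ∧ collapse x b = z := by
  rw [collapse]
  simp [and_assoc]

/-- The set `x ∩ κ` for `x ∈ P_κ(θ)`. -/
noncomputable def critTrace (x : PKappa κ θ) : ZFSet.{u} :=
  imageSet ordinalSet {a ∈ x.1 | a.toOrd < κ.ord}

namespace SupercompactnessEmbedding

variable (E : SupercompactnessEmbedding κ θ)

theorem eval_collapse (a : θ.ord.ToType) :
    E.eval (fun x => collapse x.1 a) = ordinalSet a := by
  induction a using WellFoundedLT.induction with
  | ind a ih =>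
  ext z
  rw [E.mem_eval_iff_of_forall_mem_iff (G := fun b x => collapse x.1 b) (s := Set.Iio a)
    fun _ _ => mem_collapse, mem_ordinalSet_iff]
  exact exists_congr fun b => and_congr_right fun hb => by rw [ih b hb]

theorem eval_critTrace (hκθ : κ ≤ θ) :
    E.eval (critTrace (κ := κ) (θ := θ)) = κ.ord.toZFSet := by
  ext z
  rw [E.mem_eval_iff_of_forall_mem_iff (G := fun a _ => ordinalSet a)
    (s := {a | a.toOrd < κ.ord}) fun _ _ => by simp [critTrace, mem_imageSet, and_assoc],
    ← imageSet_ordinalSet_setOf_lt (ord_le_ord.2 hκθ), mem_imageSet]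
  exact exists_congr fun a => and_congr_right fun ha => by
    rw [eval_const, ordinalSet, E.fixes_below _ ha]

end SupercompactnessEmbedding

/-- The set of `x` such that `otp (x ∩ a) ∈ ℓ(x ∩ κ)`. -/
def guessSet (ℓ : ZFSet.{u}) (a : θ.ord.ToType) : Set (PKappa κ θ) :=
  {x | ∃ b, ZFSet.pair (critTrace x) b ∈ ℓ ∧ collapse x.1 a ∈ b}

namespace Guesses

variable {E E' : SupercompactnessEmbedding κ θ} {ℓ d c : ZFSet.{u}}

theorem eventually_mem_guessSet_iff {t : ZFSet.{u}} (hκθ : κ ≤ θ) (hℓ : ZFSet.IsFunc d c ℓ)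
    (ht : Guesses E ℓ t) (a : θ.ord.ToType) :
    (∀ᶠ x in (E.measure : Filter (PKappa κ θ)), x ∈ guessSet ℓ a) ↔ ordinalSet a ∈ t := by
  have hjℓ : ZFSet.IsFunc (E.j d) (E.j c) (E.j ℓ : ZFSet.{u}) :=
    (E.transfer (.isFunc (0 : Fin 3) 1 2) ![d, c, ℓ]).2 hℓ
  have hbound (x : PKappa κ θ) : x ∈ guessSet ℓ a ↔
      ∃ b ∈ c, ZFSet.pair (critTrace x) b ∈ ℓ ∧ collapse x.1 a ∈ b :=
    exists_congr fun b => (and_iff_right_of_imp fun h => (ZFSet.pair_mem_prod.1 (hℓ.1 h.1)).2).symm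
  have hlos : (∀ᶠ x in (E.measure : Filter (PKappa κ θ)),
      ∃ b ∈ c, ZFSet.pair (critTrace x) b ∈ ℓ ∧ collapse x.1 a ∈ b) ↔
      ∃ b ∈ E.eval fun _ => c,
        ZFSet.pair (E.eval critTrace) b ∈ E.eval (fun _ => ℓ) ∧
          E.eval (fun x => collapse x.1 a) ∈ b :=
    E.eventually_measure_iff
      (P := fun v : Fin 4 → ZFSet.{u} => ∃ b ∈ v 0, ZFSet.pair (v 1) b ∈ v 2 ∧ v 3 ∈ b)
      (.bex _ (.and (.pair_mem _ _ _) (.mem _ _)))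
      ![fun _ => c, critTrace, fun _ => ℓ, fun x => collapse x.1 a]
  simp only [hbound]
  rw [hlos, E.eval_const, E.eval_const, E.eval_critTrace hκθ, E.eval_collapse]
  constructor
  · rintro ⟨b, -, hb, hab⟩
    rwa [eq_of_pair_mem_of_isFunc hjℓ ht hb]
  · intro hat
    exact ⟨t, (ZFSet.pair_mem_prod.1 (hjℓ.1 ht)).2, ht, hat⟩

theorem eq_of_measure_eq (hκθ : κ ≤ θ) (hℓ : ZFSet.IsFunc d c ℓ) {A B : Set θ.ord.ToType}
    (hA : Guesses E ℓ (imageSet ordinalSet A)) (hB : Guesses E' ℓ (imageSet ordinalSet B))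
    (h : E.measure = E'.measure) : A = B := by
  ext a
  rw [← apply_mem_imageSet_iff ordinalSet_injective, ← hA.eventually_mem_guessSet_iff hκθ hℓ, h,
    hB.eventually_mem_guessSet_iff hκθ hℓ, apply_mem_imageSet_iff ordinalSet_injective]

end Guesses

end JointLaver

theorem proposition3p9 (κ θ : Cardinal.{u}) (lam : Ordinal.{u}) (hκθ : κ ≤ θ)
    (h : ∃ ℓ : Set.Iio lam → ZFSet.{u}, JointLaver.IsJointLaverSequence κ θ lam ℓ) :
    2 ^ (θ * lam.card) ≤
      #{U : Ultrafilter (JointLaver.PKappa κ θ) // JointLaver.IsNormalMeasure U} := by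
  open JointLaver in
  obtain ⟨ℓ, hℓ, hjoint⟩ := h
  have hguess (A : lam.ToType → Set θ.ord.ToType) : ∃ E : SupercompactnessEmbedding κ θ,
      ∀ α, Guesses E (ℓ α) (imageSet ordinalSet (A (Ordinal.ToType.mk α))) :=
    hjoint _ fun _ => memH_imageSet_ordinalSet _
  choose E hE using hguess
  have hinj : Function.Injective fun A =>
      (⟨(E A).measure, (E A).isNormalMeasure_measure⟩ :
        {U : Ultrafilter (PKappa κ θ) // IsNormalMeasure U}) := by
    intro A B hAB
    funext i
    obtain ⟨α, rfl⟩ := Ordinal.ToType.mk.surjective i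
    exact (hE A α).eq_of_measure_eq hκθ (hℓ α).1 (hE B α) (congrArg Subtype.val hAB)
  calc (2 : Cardinal.{u}) ^ (θ * lam.card) = #(lam.ToType → Set θ.ord.ToType) := by
        simp [power_mul]
    _ ≤ _ := mk_le_of_injective hinj
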